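/- Let $\mathbb{S}^2\subset\mathbb{R}^3$ be the unit sphere and let $\mu$ be its surface (Lebesgue) measure, normalized so that $\mu(\mathbb{S}^2)=1$. A set $S\subseteq\mathbb{S}^2$ is called orthogonal-pair-free if there are no points $p,q\in S$ for which the angle between the rays from the origin through $p$ and $q$ is $\frac{\pi}{2}$. A set $C\subseteq\mathbb{S}^2$ is called convex if for all $x,y\in C$ with $y\neq -x$ it contains the geodesic segment (the shorter great-circle arc) between $x$ and $y$. Two sets $A,B\subseteq\mathbb{S}^2$ are called mutually disjoint if $\mathrm{cl}(A)\cap \mathrm{cl}(B)=\emptyset$. For $k\in\mathbb{N}$ let $\mathcal{A}_k$ be the collection of all orthogonal-pair-free sets $S\subseteq\mathbb{S}^2$ that are a union of at most $k$ pairwise mutually disjoint convex sets. Then for every $k\in\mathbb{N}$ there is a set $M^*_k\in\mathcal{A}_k$ such that $$\mu(M^*_k)=\sup_{S\in\mathcal{A}_k}\mu(S).$$ -/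

import Mathlib

open MeasureTheory

noncomputable section

/-- The unit sphere `𝕊²` of `ℝ³`, centred at the origin. -/
abbrev S2 : Type := Metric.sphere (0 : EuclideanSpace ℝ (Fin 3)) 1

/-- The surface (Lebesgue) measure on the sphere, normalized to total mass `1`. -/
def sphereMeasure : Measure S2 :=
  ((volume : Measure (EuclideanSpace ℝ (Fin 3))).toSphere Set.univ)⁻¹ •
    (volume : Measure (EuclideanSpace ℝ (Fin 3))).toSphere

/-- Two points form an orthogonal pair if the angle between the rays from the origin through
them is `π / 2`. -/
def IsOrthogonalPair (p q : S2) : Prop :=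
  InnerProductGeometry.angle (p : EuclideanSpace ℝ (Fin 3)) (q : EuclideanSpace ℝ (Fin 3)) =
    Real.pi / 2

/-- A set without orthogonal pairs. -/
def OrthogonalPairFree (A : Set S2) : Prop :=
  ∀ p ∈ A, ∀ q ∈ A, ¬ IsOrthogonalPair p q

/-- For `y ≠ -x`, the geodesic segment between `x` and `y`, that is, the shorter arc of the great
circle through `x` and `y`: the points of the sphere in the convex cone spanned by `x` and `y`. -/
def geodesicSegment (x y : S2) : Set S2 :=
  {z | ∃ a b : ℝ, 0 ≤ a ∧ 0 ≤ b ∧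
    (z : EuclideanSpace ℝ (Fin 3)) =
      a • (x : EuclideanSpace ℝ (Fin 3)) + b • (y : EuclideanSpace ℝ (Fin 3))}

/-- Spherical convexity: the set contains the geodesic segment between any two of its
non-antipodal points. -/
def SphericallyConvex (C : Set S2) : Prop :=
  ∀ x ∈ C, ∀ y ∈ C, y ≠ -x → geodesicSegment x y ⊆ C

/-- Two sets are mutually disjoint if their closures are disjoint. -/
def MutuallyDisjoint (A B : Set S2) : Prop :=
  closure A ∩ closure B = ∅

/-- The class `𝒜_k` of orthogonal-pair-free sets that consist of at most `k` mutually disjoint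
convex sets. -/
def convexClass (k : ℕ) : Set (Set S2) :=
  {S | OrthogonalPairFree S ∧
    ∃ n : ℕ, n ≤ k ∧ ∃ C : Fin n → Set S2,
      (∀ i, SphericallyConvex (C i)) ∧
      (∀ i j, i ≠ j → MutuallyDisjoint (C i) (C j)) ∧
      S = ⋃ i, C i}

end

open Set TopologicalSpace
open scoped Pointwise

noncomputable section

/-! An arc joining two sides of a plane `x⊥` meets it. So in an orthogonal-pair-free union of convex
sets, inner products keep a constant sign within a piece and between two pieces, except that a piece
with antipodal points is a null set (`SphericallyConvex.subset_antipodal_pair`). Relaxed to weak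
inequalities, without convexity or disjointness, this gives `IsSignedFamily`. The relaxed condition
is closed on the compact space of `k`-tuples of compact sets, where the area of the union is upper
semicontinuous, so a maximal family exists.

The way back replaces each member by the interior of its conical hull, cut with the sphere. This is
convex, loses only a null set, and makes the inequalities strict, which excludes orthogonal pairs.
If the closures of two such hulls meet, the members can be merged without breaking the sign pattern,
once null members are discarded (`IsSignedFamily.insert_union`). -/

/-- The ambient Euclidean space of the sphere `S2`. -/
abbrev R3 : Type := EuclideanSpace ℝ (Fin 3)

/-! ### The surface measure -/

instance : IsFiniteMeasure sphereMeasure := by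
  constructor
  rw [sphereMeasure, Measure.smul_apply, smul_eq_mul]
  refine ENNReal.mul_lt_top ?_ (measure_lt_top _ _)
  rw [ENNReal.inv_lt_top, pos_iff_ne_zero, Ne, Measure.measure_univ_eq_zero]
  exact Measure.toSphere_ne_zero _

/-- A set that is contained in a Borel null cone is a null set of the sphere. -/
theorem sphereMeasure_preimage_eq_zero {N : Set R3} (hN : MeasurableSet N) (h0 : volume N = 0)
    (hcone : ∀ t : ℝ, 0 < t → ∀ x ∈ N, t • x ∈ N) :
    sphereMeasure ((↑) ⁻¹' N : Set S2) = 0 := by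
  have hmeas : MeasurableSet ((↑) ⁻¹' N : Set S2) := measurable_subtype_coe hN
  rw [sphereMeasure, Measure.smul_apply, Measure.toSphere_apply' _ hmeas, measure_mono_null _ h0]
  · simp
  · rintro _ ⟨t, ht, _, ⟨x, hx, rfl⟩, rfl⟩
    exact hcone t ht.1 _ hx

theorem sphereMeasure_eq_zero_of_subset_submodule {A : Set S2} {V : Submodule ℝ R3} (hV : V ≠ ⊤)
    (hA : ∀ x ∈ A, (x : R3) ∈ V) : sphereMeasure A = 0 :=
  measure_mono_null hA <| sphereMeasure_preimage_eq_zero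
    V.closed_of_finiteDimensional.measurableSet (Measure.addHaar_submodule _ V hV)
    fun t _ _ hx => V.smul_mem t hx

theorem sphereMeasure_antipodal_pair (x : S2) : sphereMeasure {x, -x} = 0 := by
  refine sphereMeasure_eq_zero_of_subset_submodule (V := Submodule.span ℝ {(x : R3)}) ?_ ?_
  · intro h
    have h1 := finrank_span_singleton (K := ℝ) (ne_zero_of_mem_unit_sphere x)
    rw [h, finrank_top, finrank_euclideanSpace] at h1
    simp at h1
  · rintro y (rfl | rfl)
    · exact Submodule.mem_span_singleton_self _
    · exact neg_mem (Submodule.mem_span_singleton_self _)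

/-! ### Sets with inner products of constant sign -/

/-- All inner products between points of `A` and points of `B` are nonnegative. -/
def InnerNonneg (A B : Set S2) : Prop :=
  ∀ x ∈ A, ∀ y ∈ B, 0 ≤ inner ℝ (x : R3) (y : R3)

/-- All inner products between points of `A` and points of `B` are nonpositive. -/
def InnerNonpos (A B : Set S2) : Prop :=
  ∀ x ∈ A, ∀ y ∈ B, inner ℝ (x : R3) (y : R3) ≤ 0

/-- A family of sets such that inner products within each member are nonnegative, and inner
products between any two members have a constant sign. -/
structure IsSignedFamily (𝓕 : Set (Set S2)) : Prop where
  self : ∀ A ∈ 𝓕, InnerNonneg A A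
  pair : ∀ A ∈ 𝓕, ∀ B ∈ 𝓕, InnerNonneg A B ∨ InnerNonpos A B

theorem InnerNonneg.symm {A B : Set S2} (h : InnerNonneg A B) : InnerNonneg B A :=
  fun x hx y hy => by rw [real_inner_comm]; exact h y hy x hx

theorem InnerNonpos.symm {A B : Set S2} (h : InnerNonpos A B) : InnerNonpos B A :=
  fun x hx y hy => by rw [real_inner_comm]; exact h y hy x hx

theorem innerNonneg_iff_prod_subset {A B : Set S2} :
    InnerNonneg A B ↔ A ×ˢ B ⊆ {p : S2 × S2 | 0 ≤ inner ℝ (p.1 : R3) (p.2 : R3)} :=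
  ⟨fun h _ hp => h _ hp.1 _ hp.2, fun h _ hx _ hy => h (mk_mem_prod hx hy)⟩

theorem innerNonpos_iff_prod_subset {A B : Set S2} :
    InnerNonpos A B ↔ A ×ˢ B ⊆ {p : S2 × S2 | inner ℝ (p.1 : R3) (p.2 : R3) ≤ 0} :=
  ⟨fun h _ hp => h _ hp.1 _ hp.2, fun h _ hx _ hy => h (mk_mem_prod hx hy)⟩

theorem isClosed_setOf_inner_nonneg :
    IsClosed {p : S2 × S2 | 0 ≤ inner ℝ (p.1 : R3) (p.2 : R3)} :=
  isClosed_le (by fun_prop) (by fun_prop)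

theorem isClosed_setOf_inner_nonpos :
    IsClosed {p : S2 × S2 | inner ℝ (p.1 : R3) (p.2 : R3) ≤ 0} :=
  isClosed_le (by fun_prop) (by fun_prop)

theorem InnerNonneg.closure {A B : Set S2} (h : InnerNonneg A B) :
    InnerNonneg (closure A) (closure B) := by
  rw [innerNonneg_iff_prod_subset] at h ⊢
  rw [← closure_prod_eq]
  exact closure_minimal h isClosed_setOf_inner_nonneg

theorem InnerNonpos.closure {A B : Set S2} (h : InnerNonpos A B) :
    InnerNonpos (closure A) (closure B) := by
  rw [innerNonpos_iff_prod_subset] at h ⊢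
  rw [← closure_prod_eq]
  exact closure_minimal h isClosed_setOf_inner_nonpos

/-! ### Maximal compact signed families -/

/-- Outer regularity gives an open `U` around the union with measure below `c`; tuples of compact
sets inside `U` form an open set. -/
theorem upperSemicontinuous_measure_iUnion (k : ℕ) :
    UpperSemicontinuous fun F : Fin k → Compacts S2 => sphereMeasure (⋃ i, (F i : Set S2)) := by
  intro F c hc
  obtain ⟨U, hFU, hU, hUc⟩ := Set.exists_isOpen_lt_of_lt _ c hc
  have hopen : IsOpen {G : Fin k → Compacts S2 | ∀ i, (G i : Set S2) ⊆ U} := by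
    rw [ofPred_forall]
    refine isOpen_iInter_of_finite fun i => ?_
    have hi : Continuous fun G : Fin k → Compacts S2 => G i := continuous_apply i
    exact (Compacts.isOpen_subsets_of_isOpen hU).preimage hi
  filter_upwards [hopen.mem_nhds fun i => (subset_iUnion (fun i => (F i : Set S2)) i).trans hFU]
    with G hG
  exact (measure_mono (iUnion_subset hG)).trans_lt hUc

theorem isClosed_setOf_isSignedFamily (k : ℕ) :
    IsClosed {F : Fin k → Compacts S2 | IsSignedFamily (range fun i => (F i : Set S2))} := by
  have hprod (i j : Fin k) : Continuous fun F : Fin k → Compacts S2 => F i ×ˢ F j := by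
    have hpair : Continuous fun F : Fin k → Compacts S2 => (F i, F j) :=
      (continuous_apply i).prodMk (continuous_apply j)
    exact Compacts.continuous_prod.comp hpair
  have hnonneg (i j : Fin k) :
      IsClosed {F : Fin k → Compacts S2 | InnerNonneg (F i : Set S2) (F j)} := by
    simp only [innerNonneg_iff_prod_subset]
    exact (Compacts.isClosed_subsets_of_isClosed isClosed_setOf_inner_nonneg).preimage (hprod i j)
  have hnonpos (i j : Fin k) :
      IsClosed {F : Fin k → Compacts S2 | InnerNonpos (F i : Set S2) (F j)} := by
    simp only [innerNonpos_iff_prod_subset]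
    exact (Compacts.isClosed_subsets_of_isClosed isClosed_setOf_inner_nonpos).preimage (hprod i j)
  have heq : {F : Fin k → Compacts S2 | IsSignedFamily (range fun i => (F i : Set S2))} =
      (⋂ i, {F | InnerNonneg (F i : Set S2) (F i)}) ∩
        ⋂ i, ⋂ j, {F | InnerNonneg (F i : Set S2) (F j)} ∪
          {F | InnerNonpos (F i : Set S2) (F j)} := by
    ext F
    simp only [mem_ofPred_eq, mem_inter_iff, mem_iInter, mem_union]
    exact ⟨fun h => ⟨fun i => h.self _ ⟨i, rfl⟩, fun i j => h.pair _ ⟨i, rfl⟩ _ ⟨j, rfl⟩⟩,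
      fun h => ⟨forall_mem_range.2 h.1, forall_mem_range.2 fun i => forall_mem_range.2 (h.2 i)⟩⟩
  rw [heq]
  exact (isClosed_iInter fun i => hnonneg i i).inter
    (isClosed_iInter fun i => isClosed_iInter fun j => (hnonneg i j).union (hnonpos i j))

theorem exists_isSignedFamily_maximal (k : ℕ) :
    ∃ F : Fin k → Compacts S2, IsSignedFamily (range fun i => (F i : Set S2)) ∧
      ∀ G : Fin k → Compacts S2, IsSignedFamily (range fun i => (G i : Set S2)) →
        sphereMeasure (⋃ i, (G i : Set S2)) ≤ sphereMeasure (⋃ i, (F i : Set S2)) := by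
  have hne : {F : Fin k → Compacts S2 |
      IsSignedFamily (range fun i => (F i : Set S2))}.Nonempty :=
    ⟨fun _ => ⊥, forall_mem_range.2 fun i x hx => absurd hx (notMem_empty x),
      forall_mem_range.2 fun i _ _ => Or.inl fun x hx => absurd hx (notMem_empty x)⟩
  obtain ⟨F, hF, hmax⟩ := UpperSemicontinuousOn.exists_isMaxOn hne
    (isClosed_setOf_isSignedFamily k).isCompact
    ((upperSemicontinuous_measure_iUnion k).upperSemicontinuousOn _)
  exact ⟨F, hF, fun G hG => hmax hG⟩

/-! ### Orthogonal-pair-free convex sets -/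

theorem isOrthogonalPair_iff {p q : S2} :
    IsOrthogonalPair p q ↔ inner ℝ (p : R3) (q : R3) = 0 :=
  InnerProductGeometry.inner_eq_zero_iff_angle_eq_pi_div_two _ _ |>.symm

theorem inner_self_S2 (x : S2) : inner ℝ (x : R3) (x : R3) = 1 := by
  rw [real_inner_self_eq_norm_sq, norm_eq_of_mem_sphere, one_pow]

/-- Between two non-antipodal points of a convex set on different sides of the plane `x⊥` there is
a point of the set on this plane. -/
theorem SphericallyConvex.exists_inner_eq_zero {D : Set S2} (hD : SphericallyConvex D) {x y z : S2}
    (hy : y ∈ D) (hz : z ∈ D) (hzy : z ≠ -y) (hxy : 0 < inner ℝ (x : R3) (y : R3))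
    (hxz : inner ℝ (x : R3) (z : R3) < 0) : ∃ w ∈ D, inner ℝ (x : R3) (w : R3) = 0 := by
  -- The coefficients make `a • y + b • z` orthogonal to `x`; it vanishes only if `z = -y`.
  set a := -inner ℝ (x : R3) (z : R3) with ha
  set b := inner ℝ (x : R3) (y : R3) with hb
  have ha0 : 0 < a := by linarith
  set v : R3 := a • (y : R3) + b • (z : R3) with hv
  have hv0 : v ≠ 0 := by
    intro h
    have h1 : b • (z : R3) = -(a • (y : R3)) := eq_neg_of_add_eq_zero_right h
    have h2 : b = a := by
      have := congrArg norm h1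
      rwa [norm_neg, norm_smul, norm_smul, norm_eq_of_mem_sphere, norm_eq_of_mem_sphere, mul_one,
        mul_one, Real.norm_of_nonneg hxy.le, Real.norm_of_nonneg ha0.le] at this
    refine hzy (Subtype.ext ?_)
    rw [h2, ← smul_neg] at h1
    exact smul_right_injective _ ha0.ne' h1
  have hn : 0 < ‖v‖ := norm_pos_iff.2 hv0
  let w : S2 := ⟨‖v‖⁻¹ • v, by
    rw [mem_sphere_zero_iff_norm, norm_smul, norm_inv, norm_norm, inv_mul_cancel₀ hn.ne']⟩
  refine ⟨w, hD y hy z hz hzy ⟨‖v‖⁻¹ * a, ‖v‖⁻¹ * b, by positivity, by positivity, ?_⟩, ?_⟩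
  · simp only [w, hv, smul_add, smul_smul]
  · simp only [w, hv, inner_smul_right, inner_add_right, ← hb]
    rw [ha]
    ring

theorem OrthogonalPairFree.mono {A B : Set S2} (hB : OrthogonalPairFree B) (h : A ⊆ B) :
    OrthogonalPairFree A :=
  fun p hp q hq => hB p (h hp) q (h hq)

theorem OrthogonalPairFree.inner_ne_zero {A : Set S2} (hA : OrthogonalPairFree A) {x y : S2}
    (hx : x ∈ A) (hy : y ∈ A) : inner ℝ (x : R3) (y : R3) ≠ 0 :=
  fun h => hA x hx y hy (isOrthogonalPair_iff.2 h)

/-- From any third point `y` of `C`, the arc to `x` or the arc to `-x` crosses the plane `x⊥`. -/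
theorem SphericallyConvex.subset_antipodal_pair {C : Set S2} (hC : SphericallyConvex C)
    (hfree : OrthogonalPairFree C) {x : S2} (hx : x ∈ C) (hx' : -x ∈ C) : C ⊆ {x, -x} := by
  intro y hy
  by_contra hne
  rw [mem_insert_iff, mem_singleton_iff, not_or] at hne
  have hneg : inner ℝ (x : R3) ((-x : S2) : R3) < 0 := by
    rw [coe_neg_sphere, inner_neg_right, inner_self_S2]
    norm_num
  have hpos : 0 < inner ℝ (x : R3) (x : R3) := by rw [inner_self_S2]; exact one_pos
  rcases lt_or_gt_of_ne (hfree.inner_ne_zero hx hy) with h | h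
  · obtain ⟨w, hw, h0⟩ := hC.exists_inner_eq_zero hx hy hne.2 hpos h
    exact hfree.inner_ne_zero hx hw h0
  · obtain ⟨w, hw, h0⟩ := hC.exists_inner_eq_zero hy hx' (fun e => hne.1 (neg_injective e).symm) h
      hneg
    exact hfree.inner_ne_zero hx hw h0

theorem SphericallyConvex.innerNonneg_self {C : Set S2} (hC : SphericallyConvex C)
    (hfree : OrthogonalPairFree C) (hanti : ∀ x ∈ C, -x ∉ C) : InnerNonneg C C := by
  intro x hx y hy
  by_contra! h
  obtain ⟨w, hw, h0⟩ := hC.exists_inner_eq_zero hx hy (fun e => hanti x hx (e ▸ hy))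
    (by rw [inner_self_S2]; exact one_pos) h
  exact hfree.inner_ne_zero hx hw h0

theorem SphericallyConvex.innerNonneg_or_innerNonpos {C D : Set S2} (hC : SphericallyConvex C)
    (hD : SphericallyConvex D) (hfree : OrthogonalPairFree (C ∪ D)) (hantiC : ∀ x ∈ C, -x ∉ C)
    (hantiD : ∀ x ∈ D, -x ∉ D) : InnerNonneg C D ∨ InnerNonpos C D := by
  by_contra! h
  simp only [InnerNonneg, InnerNonpos, not_forall, not_le] at h
  obtain ⟨⟨x, hx, y, hy, hxy⟩, ⟨x', hx', y', hy', hxy'⟩⟩ := h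
  rcases lt_or_gt_of_ne (hfree.inner_ne_zero (Or.inl hx) (Or.inr hy')) with h | h
  · rw [real_inner_comm] at h hxy'
    obtain ⟨w, hw, h0⟩ := hC.exists_inner_eq_zero hx' hx (fun e => hantiC x' hx' (e ▸ hx)) hxy' h
    exact hfree.inner_ne_zero (Or.inr hy') (Or.inl hw) h0
  · obtain ⟨w, hw, h0⟩ := hD.exists_inner_eq_zero hy' hy (fun e => hantiD y' hy' (e ▸ hy)) h hxy
    exact hfree.inner_ne_zero (Or.inl hx) (Or.inr hw) h0

open Classical in
/-- Every member of `convexClass k` is, up to a null set, contained in the union of a signed family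
of `k` compact sets. -/
theorem exists_isSignedFamily_measure_le {k : ℕ} {S : Set S2} (hS : S ∈ convexClass k) :
    ∃ F : Fin k → Compacts S2, IsSignedFamily (range fun i => (F i : Set S2)) ∧
      sphereMeasure S ≤ sphereMeasure (⋃ i, (F i : Set S2)) := by
  obtain ⟨hfree, n, hn, C, hconv, -, rfl⟩ := hS
  let P (i : Fin n) : Prop := ∀ x ∈ C i, -x ∉ C i
  -- Surplus indices and pieces with antipodal points get the empty set; the latter pieces are null.
  let F (i : Fin k) : Compacts S2 := if h : ∃ hi : i.1 < n, P ⟨i.1, hi⟩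
    then ⟨closure (C ⟨i.1, h.1⟩), isClosed_closure.isCompact⟩ else ⊥
  have hF (i : Fin k) : (F i : Set S2) = ∅ ∨ ∃ j, P j ∧ (F i : Set S2) = closure (C j) := by
    by_cases h : ∃ hi : i.1 < n, P ⟨i.1, hi⟩
    · exact Or.inr ⟨⟨i.1, h.1⟩, h.2, by simp only [F, dif_pos h]; rfl⟩
    · exact Or.inl (by simp only [F, dif_neg h]; rfl)
  refine ⟨F, ⟨forall_mem_range.2 fun i => ?_, forall_mem_range.2 fun i =>
    forall_mem_range.2 fun j => ?_⟩, ?_⟩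
  · rcases hF i with h | ⟨l, hl, h⟩
    · rw [h]; exact fun x hx => absurd hx (notMem_empty x)
    · rw [h]
      exact ((hconv l).innerNonneg_self (hfree.mono (subset_iUnion C l)) hl).closure
  · rcases hF i with h | ⟨l, hl, h⟩
    · rw [h]; exact Or.inl fun x hx => absurd hx (notMem_empty x)
    rcases hF j with h' | ⟨m, hm, h'⟩
    · rw [h']; exact Or.inl fun x _ y hy => absurd hy (notMem_empty y)
    rw [h, h']
    exact ((hconv l).innerNonneg_or_innerNonpos (hconv m)
      (hfree.mono (union_subset (subset_iUnion C l) (subset_iUnion C m))) hl hm).imp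
      InnerNonneg.closure InnerNonpos.closure
  · have hsub : (⋃ i, C i) ⊆ (⋃ i, (F i : Set S2)) ∪ ⋃ j ∈ {j | ¬ P j}, C j := by
      refine iUnion_subset fun j x hx => ?_
      by_cases hj : P j
      · refine Or.inl (mem_iUnion.2 ⟨⟨j.1, j.2.trans_le hn⟩, ?_⟩)
        have h : ∃ hi : j.1 < n, P ⟨j.1, hi⟩ := ⟨j.2, hj⟩
        simp only [F, dif_pos h]
        exact subset_closure hx
      · exact Or.inr (mem_biUnion hj hx)
    have hnull : sphereMeasure (⋃ j ∈ {j | ¬ P j}, C j) = 0 := by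
      refine (measure_biUnion_null_iff (to_countable _)).2 fun j hj => ?_
      simp only [P, mem_ofPred_eq, not_forall, not_not] at hj
      obtain ⟨x, hx, hx'⟩ := hj
      exact measure_mono_null ((hconv j).subset_antipodal_pair
        (hfree.mono (subset_iUnion C j)) hx hx') (sphereMeasure_antipodal_pair x)
    exact (measure_mono hsub).trans ((measure_union_le _ _).trans (by rw [hnull, add_zero]))

/-! ### Interiors of conical hulls -/

/-- The part on the sphere of the interior of the convex cone generated by `A`. -/
def openHull (A : Set S2) : Set S2 :=
  (↑) ⁻¹' interior (PointedCone.hull ℝ ((↑) '' A : Set R3) : Set R3)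

theorem inner_nonneg_of_mem_hull {A : Set S2} {v : R3}
    (h : ∀ x ∈ A, 0 ≤ inner ℝ v (x : R3)) {y : R3}
    (hy : y ∈ PointedCone.hull ℝ ((↑) '' A : Set R3)) : 0 ≤ inner ℝ v y := by
  induction hy using Submodule.span_induction with
  | mem x hx => obtain ⟨x, hx, rfl⟩ := hx; exact h x hx
  | zero => rw [inner_zero_right]
  | add x y _ _ hx hy => rw [inner_add_right]; exact add_nonneg hx hy
  | smul a x _ hx =>
    change 0 ≤ inner ℝ v ((a : ℝ) • x)
    rw [inner_smul_right]
    exact mul_nonneg a.2 hx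

theorem InnerNonneg.openHull_right {A B : Set S2} (h : InnerNonneg A B) :
    InnerNonneg A (openHull B) :=
  fun x hx _ hy => inner_nonneg_of_mem_hull (h x hx) (interior_subset hy)

theorem InnerNonpos.openHull_right {A B : Set S2} (h : InnerNonpos A B) :
    InnerNonpos A (openHull B) := by
  intro x hx y hy
  have := inner_nonneg_of_mem_hull (v := -(x : R3)) (A := B)
    (fun z hz => by rw [inner_neg_left]; exact neg_nonneg.2 (h x hx z hz)) (interior_subset hy)
  rwa [inner_neg_left, neg_nonneg] at this

theorem InnerNonneg.openHull_left {A B : Set S2} (h : InnerNonneg A B) :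
    InnerNonneg (openHull A) B :=
  h.symm.openHull_right.symm

theorem InnerNonpos.openHull_left {A B : Set S2} (h : InnerNonpos A B) :
    InnerNonpos (openHull A) B :=
  h.symm.openHull_right.symm

/-- A small step from `x` along `-v` stays in `K` and strictly lowers the inner product with `v`. -/
theorem inner_pos_of_mem_interior {K : Set R3} {x v : R3} (hx : x ∈ interior K) (hv : v ≠ 0)
    (h : ∀ z ∈ K, 0 ≤ inner ℝ v z) : 0 < inner ℝ v x := by
  have hlim : Filter.Tendsto (fun t : ℝ => x - t • v) (nhds 0) (nhds x) :=
    Continuous.tendsto' (by fun_prop) _ _ (by simp)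
  obtain ⟨ε, hε, hball⟩ := Metric.eventually_nhds_iff.1
    (hlim.eventually (mem_interior_iff_mem_nhds.1 hx))
  have hz := h _ (hball (y := ε / 2) (by
    rw [Real.dist_eq, sub_zero, abs_of_pos (half_pos hε)]
    exact half_lt_self hε))
  rw [inner_sub_right, inner_smul_right] at hz
  have := mul_pos (half_pos hε) (real_inner_self_pos.2 hv)
  linarith

theorem InnerNonneg.inner_openHull_ne_zero {A : Set S2} {q : S2} (h : InnerNonneg A {q}) {p : S2}
    (hp : p ∈ openHull A) : inner ℝ (p : R3) (q : R3) ≠ 0 := by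
  rw [real_inner_comm]
  exact (inner_pos_of_mem_interior hp (ne_zero_of_mem_unit_sphere q) fun z hz =>
    inner_nonneg_of_mem_hull (h.symm q rfl) hz).ne'

theorem InnerNonpos.inner_openHull_ne_zero {A : Set S2} {q : S2} (h : InnerNonpos A {q}) {p : S2}
    (hp : p ∈ openHull A) : inner ℝ (p : R3) (q : R3) ≠ 0 := by
  have hneg : InnerNonneg A {-q} := by
    rintro x hx _ rfl
    rw [coe_neg_sphere, inner_neg_right]
    exact neg_nonneg.2 (h x hx q rfl)
  simpa [inner_neg_right] using hneg.inner_openHull_ne_zero hp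

theorem smul_mem_interior_cone {K : PointedCone ℝ R3} {t : ℝ} (ht : 0 < t) {x : R3}
    (hx : x ∈ interior (K : Set R3)) : t • x ∈ interior (K : Set R3) := by
  have h : t • (K : Set R3) ⊆ K := by
    rintro _ ⟨y, hy, rfl⟩
    exact K.smul_mem ht.le hy
  refine interior_mono h ?_
  rw [interior_smul₀ ht.ne']
  exact smul_mem_smul_set hx

theorem smul_mem_closure_cone {K : PointedCone ℝ R3} {t : ℝ} (ht : 0 < t) {x : R3}
    (hx : x ∈ closure (K : Set R3)) : t • x ∈ closure (K : Set R3) :=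
  map_mem_closure (f := fun y => t • y) (continuous_const_smul t) hx
    fun _ hy => K.smul_mem ht.le hy

theorem smul_mem_frontier_cone {K : PointedCone ℝ R3} {t : ℝ} (ht : 0 < t) {x : R3}
    (hx : x ∈ frontier (K : Set R3)) : t • x ∈ frontier (K : Set R3) := by
  refine ⟨smul_mem_closure_cone ht hx.1, fun h => hx.2 ?_⟩
  simpa [smul_smul, inv_mul_cancel₀ ht.ne'] using smul_mem_interior_cone (inv_pos.2 ht) h

theorem add_mem_interior_cone {K : PointedCone ℝ R3} {x y : R3}
    (hx : x ∈ interior (K : Set R3)) (hy : y ∈ interior (K : Set R3)) :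
    x + y ∈ interior (K : Set R3) := by
  have h := smul_mem_interior_cone (K := K) two_pos
    (K.convex.interior.midpoint_mem hx hy)
  rwa [midpoint_eq_smul_add, smul_smul, mul_invOf_self, one_smul] at h

theorem sphericallyConvex_openHull (A : Set S2) : SphericallyConvex (openHull A) := by
  rintro x hx y hy - z ⟨a, b, ha, hb, hz⟩
  change (z : R3) ∈ interior _
  rw [hz]
  rcases ha.eq_or_lt with rfl | ha
  · rcases hb.eq_or_lt with rfl | hb
    · simp only [zero_smul, add_zero] at hz
      exact absurd hz (ne_zero_of_mem_unit_sphere z)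
    · rw [zero_smul, zero_add]
      exact smul_mem_interior_cone hb hy
  · rcases hb.eq_or_lt with rfl | hb
    · rw [zero_smul, add_zero]
      exact smul_mem_interior_cone ha hx
    · exact add_mem_interior_cone (smul_mem_interior_cone ha hx) (smul_mem_interior_cone hb hy)

/-- The lost points lie on the frontier of a convex cone, which is a null cone. -/
theorem sphereMeasure_diff_openHull (A : Set S2) : sphereMeasure (A \ openHull A) = 0 := by
  refine measure_mono_null ?_ (sphereMeasure_preimage_eq_zero
    isClosed_frontier.measurableSet
    ((PointedCone.hull ℝ ((↑) '' A : Set R3)).convex.addHaar_frontier volume)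
    fun t ht x hx => smul_mem_frontier_cone ht hx)
  exact fun x hx => ⟨subset_closure (PointedCone.subset_hull (mem_image_of_mem _ hx.1)), hx.2⟩

/-! ### Merging members whose open hulls touch -/

theorem IsSignedFamily.mono {𝓕 𝓖 : Set (Set S2)} (h : IsSignedFamily 𝓖) (hsub : 𝓕 ⊆ 𝓖) :
    IsSignedFamily 𝓕 :=
  ⟨fun A hA => h.self A (hsub hA), fun A hA B hB => h.pair A (hsub hA) B (hsub hB)⟩

theorem sphereMeasure_eq_zero_of_inner_eq_zero {A : Set S2} {p : S2}
    (h : ∀ x ∈ A, inner ℝ (p : R3) (x : R3) = 0) : sphereMeasure A = 0 := by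
  refine sphereMeasure_eq_zero_of_subset_submodule (V := (Submodule.span ℝ {(p : R3)})ᗮ) ?_
    fun x hx => Submodule.mem_orthogonal_singleton_iff_inner_right.2 (h x hx)
  intro htop
  have hp : (p : R3) ∈ (Submodule.span ℝ {(p : R3)})ᗮ := htop ▸ Submodule.mem_top
  rw [Submodule.mem_orthogonal_singleton_iff_inner_right, inner_self_S2] at hp
  exact one_ne_zero hp

/-- Two members of a signed family whose open hulls touch may be replaced by their union, provided
that no member of the family is a null set. -/
theorem IsSignedFamily.insert_union {𝓕 : Set (Set S2)} (h𝓕 : IsSignedFamily 𝓕)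
    (hpos : ∀ L ∈ 𝓕, sphereMeasure L ≠ 0) {A B : Set S2} (hA : A ∈ 𝓕) (hB : B ∈ 𝓕) {p : S2}
    (hpA : p ∈ closure (openHull A)) (hpB : p ∈ closure (openHull B)) :
    IsSignedFamily (insert (A ∪ B) 𝓕) := by
  -- Weak signs pass to closures of open hulls, so a nonpositive sign would give `⟨p, p⟩ ≤ 0`.
  have hAB : InnerNonneg A B := by
    refine (h𝓕.pair A hA B hB).resolve_right fun h => ?_
    have := h.openHull_left.openHull_right.closure p hpA p hpB
    rw [inner_self_S2] at this
    exact absurd this (by norm_num)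
  have hself : InnerNonneg (A ∪ B) (A ∪ B) := by
    rintro x (hx | hx) y (hy | hy)
    · exact h𝓕.self A hA x hx y hy
    · exact hAB x hx y hy
    · exact hAB.symm x hx y hy
    · exact h𝓕.self B hB x hx y hy
  -- Opposite signs of `C` and `D` against `L` force `L` into the plane `p⊥`, so `L` would be null.
  have hmixed {C D L : Set S2} (hL : L ∈ 𝓕) (hpC : p ∈ closure (openHull C))
      (hpD : p ∈ closure (openHull D)) (h1 : InnerNonneg C L) (h2 : InnerNonpos D L) : False :=
    hpos L hL <| sphereMeasure_eq_zero_of_inner_eq_zero fun x hx =>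
      le_antisymm (h2.openHull_left.closure p hpD x (subset_closure hx))
        (h1.openHull_left.closure p hpC x (subset_closure hx))
  have hpair (L : Set S2) (hL : L ∈ 𝓕) : InnerNonneg (A ∪ B) L ∨ InnerNonpos (A ∪ B) L := by
    rcases h𝓕.pair A hA L hL with h1 | h1 <;> rcases h𝓕.pair B hB L hL with h2 | h2
    · exact Or.inl fun x hx => hx.elim (h1 x) (h2 x)
    · exact (hmixed hL hpA hpB h1 h2).elim
    · exact (hmixed hL hpB hpA h2 h1).elim
    · exact Or.inr fun x hx => hx.elim (h1 x) (h2 x)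
  refine ⟨forall_mem_insert.2 ⟨hself, h𝓕.self⟩, ?_⟩
  rintro C (rfl | hC) D (rfl | hD)
  · exact Or.inl hself
  · exact hpair D hD
  · exact (hpair C hC).imp InnerNonneg.symm InnerNonpos.symm
  · exact h𝓕.pair C hC D hD

open Classical in
/-- A finite signed family can be replaced by one that has no more members, covers at least the
same area, and whose members have mutually disjoint open hulls. -/
theorem IsSignedFamily.exists_mutuallyDisjoint (𝓕 : Finset (Set S2))
    (h𝓕 : IsSignedFamily (𝓕 : Set (Set S2))) :
    ∃ 𝓖 : Finset (Set S2), 𝓖.card ≤ 𝓕.card ∧ IsSignedFamily (𝓖 : Set (Set S2)) ∧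
      sphereMeasure (⋃₀ (𝓕 : Set (Set S2))) ≤ sphereMeasure (⋃₀ (𝓖 : Set (Set S2))) ∧
      ∀ A ∈ 𝓖, ∀ B ∈ 𝓖, A ≠ B → MutuallyDisjoint (openHull A) (openHull B) := by
  induction hn : 𝓕.card using Nat.strong_induction_on generalizing 𝓕 with
  | _ n ih =>
  subst hn
  have step (𝓗 : Finset (Set S2)) (hcard : 𝓗.card < 𝓕.card)
      (h𝓗 : IsSignedFamily (𝓗 : Set (Set S2)))
      (hle : sphereMeasure (⋃₀ (𝓕 : Set (Set S2))) ≤ sphereMeasure (⋃₀ (𝓗 : Set (Set S2)))) :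
      ∃ 𝓖 : Finset (Set S2), 𝓖.card ≤ 𝓕.card ∧ IsSignedFamily (𝓖 : Set (Set S2)) ∧
        sphereMeasure (⋃₀ (𝓕 : Set (Set S2))) ≤ sphereMeasure (⋃₀ (𝓖 : Set (Set S2))) ∧
        ∀ A ∈ 𝓖, ∀ B ∈ 𝓖, A ≠ B → MutuallyDisjoint (openHull A) (openHull B) := by
    obtain ⟨𝓖, h1, h2, h3, h4⟩ := ih _ hcard 𝓗 h𝓗 rfl
    exact ⟨𝓖, h1.trans hcard.le, h2, hle.trans h3, h4⟩
  by_cases hnull : ∃ L ∈ 𝓕, sphereMeasure L = 0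
  · obtain ⟨L, hL, hL0⟩ := hnull
    refine step (𝓕.erase L) (Finset.card_erase_lt_of_mem hL)
      (h𝓕.mono (by exact_mod_cast Finset.erase_subset L 𝓕)) ?_
    have hsub : ⋃₀ (𝓕 : Set (Set S2)) ⊆ ⋃₀ (𝓕.erase L : Set (Set S2)) ∪ L := by
      rintro x ⟨A, hA, hx⟩
      by_cases hAL : A = L
      · exact Or.inr (hAL ▸ hx)
      · exact Or.inl ⟨A, by exact_mod_cast Finset.mem_erase.2 ⟨hAL, hA⟩, hx⟩
    exact (measure_mono hsub).trans ((measure_union_le _ _).trans (by rw [hL0, add_zero]))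
  · push Not at hnull
    by_cases hdisj : ∀ A ∈ 𝓕, ∀ B ∈ 𝓕, A ≠ B → MutuallyDisjoint (openHull A) (openHull B)
    · exact ⟨𝓕, le_rfl, h𝓕, le_rfl, hdisj⟩
    push Not at hdisj
    obtain ⟨A, hA, B, hB, hne, htouch⟩ := hdisj
    obtain ⟨p, hpA, hpB⟩ := nonempty_iff_ne_empty.2 htouch
    -- Two members leave and at most one enters, so the cardinality drops.
    refine step (insert (A ∪ B) ((𝓕.erase A).erase B)) ?_
      ((h𝓕.insert_union hnull hA hB hpA hpB).mono ?_) (measure_mono ?_)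
    · have h1 := Finset.card_insert_le (A ∪ B) ((𝓕.erase A).erase B)
      have h2 := Finset.card_erase_lt_of_mem (Finset.mem_erase.2 ⟨hne.symm, hB⟩)
      have h3 := Finset.card_erase_lt_of_mem hA
      omega
    · rw [Finset.coe_insert]
      exact insert_subset_insert (by
        exact_mod_cast (Finset.erase_subset _ _).trans (Finset.erase_subset _ _))
    · rintro x ⟨C, hC, hx⟩
      by_cases h : C = A ∨ C = B
      · refine ⟨A ∪ B, by simp, ?_⟩
        rcases h with rfl | rfl
        exacts [Or.inl hx, Or.inr hx]
      · push Not at h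
        exact ⟨C, by simpa [h.1, h.2] using Or.inr hC, hx⟩

theorem IsSignedFamily.orthogonalPairFree_biUnion_openHull {𝓖 : Set (Set S2)}
    (h𝓖 : IsSignedFamily 𝓖) : OrthogonalPairFree (⋃ A ∈ 𝓖, openHull A) := by
  intro p hp q hq h
  rw [isOrthogonalPair_iff] at h
  simp only [mem_iUnion] at hp hq
  obtain ⟨A, hA, hpA⟩ := hp
  obtain ⟨B, hB, hqB⟩ := hq
  rcases h𝓖.pair A hA B hB with hAB | hAB
  -- Weak signs between `A` and the single point `q` suffice: `p` being interior to the cone over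
  -- `A` makes them strict.
  · refine InnerNonneg.inner_openHull_ne_zero (A := A) ?_ hpA h
    rintro x hx _ rfl
    exact hAB.openHull_right x hx _ hqB
  · refine InnerNonpos.inner_openHull_ne_zero (A := A) ?_ hpA h
    rintro x hx _ rfl
    exact hAB.openHull_right x hx _ hqB

/-- The area covered by a finite signed family is attained by a member of `convexClass`. -/
theorem IsSignedFamily.exists_mem_convexClass {k : ℕ} {𝓕 : Finset (Set S2)}
    (h𝓕 : IsSignedFamily (𝓕 : Set (Set S2))) (hcard : 𝓕.card ≤ k) :
    ∃ M ∈ convexClass k, sphereMeasure (⋃₀ (𝓕 : Set (Set S2))) ≤ sphereMeasure M := by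
  obtain ⟨𝓖, hle, h𝓖, hmeas, hdisj⟩ := h𝓕.exists_mutuallyDisjoint
  refine ⟨⋃ A ∈ 𝓖, openHull A, ⟨h𝓖.orthogonalPairFree_biUnion_openHull, 𝓖.card,
    hle.trans hcard, fun i => openHull (𝓖.equivFin.symm i),
    fun i => sphericallyConvex_openHull _, fun i j hij => ?_, ?_⟩, hmeas.trans ?_⟩
  · refine hdisj _ (𝓖.equivFin.symm i).2 _ (𝓖.equivFin.symm j).2 fun h => hij ?_
    exact 𝓖.equivFin.symm.injective (Subtype.ext h)
  · rw [𝓖.equivFin.symm.surjective.iUnion_comp fun A : 𝓖 => openHull A, iUnion_subtype]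
  · have hsub : ⋃₀ (𝓖 : Set (Set S2)) ⊆
        (⋃ A ∈ 𝓖, openHull A) ∪ ⋃ A ∈ (𝓖 : Set (Set S2)), A \ openHull A := by
      rintro x ⟨A, hA, hx⟩
      by_cases h : x ∈ openHull A
      · exact Or.inl (mem_biUnion (t := openHull) hA h)
      · exact Or.inr (mem_biUnion (t := fun A => A \ openHull A) hA ⟨hx, h⟩)
    have hnull : sphereMeasure (⋃ A ∈ (𝓖 : Set (Set S2)), A \ openHull A) = 0 :=
      (measure_biUnion_null_iff 𝓖.countable_toSet).2 fun A _ => sphereMeasure_diff_openHull A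
    exact (measure_mono hsub).trans ((measure_union_le _ _).trans (by rw [hnull, add_zero]))

end

theorem theorem2 (k : ℕ) :
    ∃ M ∈ convexClass k, sphereMeasure M = ⨆ S ∈ convexClass k, sphereMeasure S := by
  classical
  obtain ⟨F, hF, hmax⟩ := exists_isSignedFamily_maximal k
  have hcoe : ((Finset.univ.image fun i => (F i : Set S2) : Finset (Set S2)) : Set (Set S2)) =
      range fun i => (F i : Set S2) := by simp
  obtain ⟨M, hM, hle⟩ := IsSignedFamily.exists_mem_convexClass (hcoe ▸ hF)
    (Finset.card_image_le.trans (Finset.card_fin k).le)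
  rw [hcoe, sUnion_range] at hle
  refine ⟨M, hM, le_antisymm (le_iSup₂_of_le M hM le_rfl) (iSup₂_le fun S hS => ?_)⟩
  obtain ⟨G, hG, hSG⟩ := exists_isSignedFamily_measure_le hS
  exact hSG.trans ((hmax G hG).trans hle)
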